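/- There exist absolute constants $c, C > 0$ such that for every $\varepsilon > 0$ there is $x_0 = x_0(\varepsilon)$ such that for every real $x \ge x_0$ the interval $[x, x + x^{5/9+\varepsilon}]$ contains an integer $n = p_1 p_2 m$, where $p_1, p_2$ are primes, $m$ is a positive integer, and $c\,x^{1/3} \le p_1, p_2, m \le C\,x^{1/3}$. -/

import Mathlib

open Finset MeasureTheory

/-! Put `N = x ^ (1/3)`, `H = x ^ (5/9 + ε)`, and let `A` be the primes in `(M, 2M]` with `M = N` or
`M = 2N`. It suffices to find `a, b ∈ A` such that an integer `m` lies within about `δ = H / (8 M ^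
2)`, at least `M ^ (-1/3)`, of `x / (a b) + δ`: then `a b m` exceeds `x` by at most `H`.

Suppose no such pair exists. Every Dirichlet kernel of length `K` at these points is then at most `1
/ (2δ)`. Averaging fourth powers over all pairs, the solutions of `k₁ + k₂ = k₃ + k₄` contribute at
least `K ^ 3 / 2` per pair, so once `K ^ 3 δ ^ 4 ≥ 1` the sums `∑ e(h x / (a b))` with `0 < h < 2K`
must be large on average (`exponential_sums_large`). This allows `K ≍ M ^ (4/9)`.

On the other hand, view `h / a` as frequencies and `x / b` as well-spaced sample points. The double
large sieve (`large_sieve`), with the near-injectivity of fraction differences (`injOn_det`), bounds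
the total of these sums by about `K M ^ (1/2) #A` up to logarithms (`sum_norm_bilinear_sq_le`). This
is smaller than `#A ^ 2` as soon as `K` is below `M ^ (1/2)` by a power of `M`, a contradiction.
Second moments would need `K ≍ M ^ (2/3)`, which is too long; fourth moments suffice. -/

/-! ### The additive character and its integrals -/

/-- The additive character `t ↦ exp (2 π i t)`. -/
noncomputable def expi (t : ℝ) : ℂ := Complex.exp ((2 * Real.pi * t : ℝ) * Complex.I)

lemma expi_add (s t : ℝ) : expi (s + t) = expi s * expi t := by
  unfold expi
  rw [← Complex.exp_add]
  push_cast
  ring_nf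

@[simp] lemma norm_expi (t : ℝ) : ‖expi t‖ = 1 := Complex.norm_exp_ofReal_mul_I _

@[simp] lemma expi_zero : expi 0 = 1 := by simp [expi]

lemma conj_expi (t : ℝ) : (starRingEnd ℂ) (expi t) = expi (-t) := by
  unfold expi
  rw [← Complex.exp_conj, map_mul, Complex.conj_ofReal, Complex.conj_I]
  push_cast
  ring_nf

lemma continuous_expi : Continuous expi := by
  unfold expi
  fun_prop

lemma expi_natCast_mul (k : ℕ) (t : ℝ) : expi (k * t) = expi t ^ k := by
  unfold expi
  rw [← Complex.exp_nat_mul]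
  push_cast
  ring_nf

lemma expi_int (m : ℤ) : expi m = 1 := by
  unfold expi
  rw [Complex.exp_eq_one_iff]
  exact ⟨m, by push_cast; ring⟩

lemma integral_expi {v : ℝ} (hv : v ≠ 0) (T : ℝ) :
    ∫ t in (-T)..T, expi (v * t) = ((Real.sin (2 * Real.pi * v * T) / (Real.pi * v) : ℝ) : ℂ) := by
  have h : ∀ t : ℝ, expi (v * t) = Complex.exp ((2 * Real.pi * v * Complex.I) * t) := by
    intro t
    unfold expi
    push_cast
    ring_nf
  have hpi : (Real.pi : ℂ) ≠ 0 := by exact_mod_cast Real.pi_ne_zero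
  have hv' : (v : ℂ) ≠ 0 := by exact_mod_cast hv
  simp_rw [h]
  rw [integral_exp_mul_complex (by simp [hpi, hv'])]
  push_cast
  rw [Complex.sin]
  have e1 : (2 * Real.pi * v * Complex.I : ℂ) * (T : ℂ) = 2 * Real.pi * v * T * Complex.I := by ring
  have e2 : (2 * Real.pi * v * Complex.I : ℂ) * (-T : ℂ) = -(2 * Real.pi * v * T) * Complex.I := by
    ring
  rw [e1, e2]
  field_simp
  rw [Complex.I_sq]
  ring

lemma norm_integral_expi_le_inv {v : ℝ} (hv : v ≠ 0) (T : ℝ) :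
    ‖∫ t in (-T)..T, expi (v * t)‖ ≤ 1 / |v| := by
  rw [integral_expi hv, Complex.norm_real, Real.norm_eq_abs, abs_div, abs_mul,
    abs_of_pos Real.pi_pos]
  have h1 := Real.abs_sin_le_one (2 * Real.pi * v * T)
  have hv' : 0 < |v| := abs_pos.mpr hv
  have hpi : 1 ≤ Real.pi := by linarith [Real.pi_gt_three]
  exact div_le_div₀ zero_le_one h1 hv' (by nlinarith)

lemma norm_integral_expi_le {T : ℝ} (hT : 0 ≤ T) (v : ℝ) :
    ‖∫ t in (-T)..T, expi (v * t)‖ ≤ 2 * T := by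
  have := intervalIntegral.norm_integral_le_of_norm_le_const (a := -T) (b := T) (C := 1)
    (f := fun t => expi (v * t)) (fun t _ => by simp)
  rw [abs_of_nonneg (by linarith)] at this
  linarith

/-- Jordan's inequality for the sine: on so short a window the phase varies too little to cancel. It
permits division by this integral in `large_sieve`. -/
lemma le_norm_integral_expi {v η : ℝ} (hv : 0 < v) (hη : 0 < η) (h : v * η ≤ 1 / 4) :
    η ≤ ‖∫ t in (-η)..η, expi (v * t)‖ := by
  have hpi := Real.pi_pos
  have h0 : 0 ≤ 2 * Real.pi * v * η := by positivity
  have h1 : 2 * Real.pi * v * η ≤ Real.pi / 2 := by nlinarith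
  have h2 := Real.mul_le_sin h0 h1
  have h3 : 2 / Real.pi * (2 * Real.pi * v * η) = 4 * (v * η) := by field_simp; ring
  rw [h3] at h2
  rw [integral_expi hv.ne', Complex.norm_real, Real.norm_eq_abs]
  refine le_trans ?_ (le_abs_self _)
  rw [le_div_iff₀ (by positivity)]
  have h4 := Real.pi_lt_four
  have h5 : 0 < v * η := by positivity
  nlinarith

lemma integral_expi_translate (v η y : ℝ) :
    ∫ t in (y - η)..(y + η), expi (v * t) = expi (v * y) * ∫ t in (-η)..η, expi (v * t) := by
  rw [← intervalIntegral.integral_const_mul]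
  have : ∀ t, expi (v * y) * expi (v * t) = expi (v * (t + y)) := by
    intro t
    rw [← expi_add]
    ring_nf
  simp_rw [this]
  rw [intervalIntegral.integral_comp_add_right (fun t => expi (v * t))]
  ring_nf

/-! ### The double large sieve -/

lemma norm_integral_sq_le {g : ℝ → ℂ} (hg : Continuous g) {a b : ℝ} (hab : a < b) :
    ‖∫ t in a..b, g t‖ ^ 2 ≤ (b - a) * ∫ t in a..b, ‖g t‖ ^ 2 := by
  have hn : Continuous fun t => ‖g t‖ := hg.norm
  set I := ∫ t in a..b, ‖g t‖ with hI
  have h1 : ‖∫ t in a..b, g t‖ ≤ I := intervalIntegral.norm_integral_le_integral_norm hab.le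
  -- Cauchy–Schwarz, obtained from nonnegativity of the variance of `‖g‖` about its mean `I / (b -
  -- a)`.
  have h2 : 0 ≤ ∫ t in a..b, (‖g t‖ - I / (b - a)) ^ 2 :=
    intervalIntegral.integral_nonneg hab.le fun t _ => sq_nonneg _
  have h3 : ∫ t in a..b, (‖g t‖ - I / (b - a)) ^ 2 =
      (∫ t in a..b, ‖g t‖ ^ 2) - 2 * (I / (b - a)) * I + (b - a) * (I / (b - a)) ^ 2 := by
    have e : ∀ t, (‖g t‖ - I / (b - a)) ^ 2 =
        (‖g t‖ ^ 2 - 2 * (I / (b - a)) * ‖g t‖) + (I / (b - a)) ^ 2 := fun t => by ring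
    simp_rw [e]
    rw [intervalIntegral.integral_add, intervalIntegral.integral_sub,
      intervalIntegral.integral_const_mul, intervalIntegral.integral_const, smul_eq_mul]
    all_goals exact Continuous.intervalIntegrable (by fun_prop) _ _
  have hba : 0 < b - a := sub_pos.mpr hab
  have h4 : (b - a) * ((∫ t in a..b, ‖g t‖ ^ 2) - 2 * (I / (b - a)) * I
      + (b - a) * (I / (b - a)) ^ 2) = (b - a) * (∫ t in a..b, ‖g t‖ ^ 2) - I ^ 2 := by
    field_simp
    ring
  have h5 := mul_nonneg hba.le (h3 ▸ h2)
  have h6 : ‖∫ t in a..b, g t‖ ^ 2 ≤ I ^ 2 := pow_le_pow_left₀ (norm_nonneg _) h1 2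
  linarith

/-- The windows of radius `η` are disjoint and lie in `[-T, T]`. -/
lemma sum_integral_le_of_spaced {β : Type*} {G : ℝ → ℝ} (hG : Continuous G) (hG0 : ∀ t, 0 ≤ G t)
    (s : Finset β) (y : β → ℝ) {η T : ℝ} (hη : 0 < η)
    (hsep : ∀ b ∈ s, ∀ b' ∈ s, b ≠ b' → 2 * η ≤ |y b - y b'|)
    (hT : ∀ b ∈ s, |y b| + η ≤ T) (hT0 : 0 ≤ T) :
    ∑ b ∈ s, ∫ t in (y b - η)..(y b + η), G t ≤ ∫ t in (-T)..T, G t := by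
  have h1 : ∀ b ∈ s, ∫ t in (y b - η)..(y b + η), G t =
      ∫ t in Set.Ioc (y b - η) (y b + η), G t := fun b _ =>
    intervalIntegral.integral_of_le (by linarith)
  rw [Finset.sum_congr rfl h1, intervalIntegral.integral_of_le (by linarith),
    ← integral_biUnion_finset]
  · refine setIntegral_mono_set ?_ (Filter.Eventually.of_forall hG0) ?_
    · exact (hG.intervalIntegrable (-T) T).1
    · refine (Set.iUnion₂_subset fun b hb => ?_).eventuallyLE
      have h := hT b hb
      have := abs_le.mp (le_refl |y b|)
      exact Set.Ioc_subset_Ioc (by linarith) (by linarith)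
  · exact fun b _ => measurableSet_Ioc
  · intro b hb b' hb' hne
    rw [Function.onFun, Set.disjoint_left]
    rintro t ⟨h1, h2⟩ ⟨h3, h4⟩
    have := hsep b hb b' hb' hne
    rcases abs_cases (y b - y b') with h | h <;> linarith
  · exact fun b _ => (hG.intervalIntegrable _ _).1

lemma integral_norm_sq_sum_expi_le {ι : Type*} (s : Finset ι) (v : ι → ℝ) (d : ι → ℂ) {D : ℝ}
    (hd : ∀ k ∈ s, ‖d k‖ ≤ D) (T : ℝ) :
    ∫ t in (-T)..T, ‖∑ k ∈ s, d k * expi (v k * t)‖ ^ 2 ≤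
      D ^ 2 * ∑ k ∈ s, ∑ l ∈ s, ‖∫ t in (-T)..T, expi ((v k - v l) * t)‖ := by
  have h1 : ∀ t : ℝ, ((‖∑ k ∈ s, d k * expi (v k * t)‖ ^ 2 : ℝ) : ℂ) =
      ∑ k ∈ s, ∑ l ∈ s, (d k * (starRingEnd ℂ) (d l)) * expi ((v k - v l) * t) := by
    intro t
    rw [Complex.ofReal_pow, ← Complex.mul_conj', map_sum, Finset.sum_mul_sum]
    refine Finset.sum_congr rfl fun k _ => Finset.sum_congr rfl fun l _ => ?_
    rw [map_mul, conj_expi, show (v k - v l) * t = v k * t + -(v l * t) by ring, expi_add]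
    ring
  have hc : ∀ k l, Continuous fun t : ℝ => (d k * (starRingEnd ℂ) (d l)) *
      expi ((v k - v l) * t) := fun k l =>
    continuous_const.mul (continuous_expi.comp (continuous_const.mul continuous_id))
  have h2 : ((∫ t in (-T)..T, ‖∑ k ∈ s, d k * expi (v k * t)‖ ^ 2 : ℝ) : ℂ) =
      ∑ k ∈ s, ∑ l ∈ s, (d k * (starRingEnd ℂ) (d l)) *
        ∫ t in (-T)..T, expi ((v k - v l) * t) := by
    rw [← intervalIntegral.integral_ofReal]
    simp_rw [h1]
    rw [intervalIntegral.integral_finsetSum fun k _ =>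
      (continuous_finsetSum _ fun l _ => hc k l).intervalIntegrable _ _]
    refine Finset.sum_congr rfl fun k _ => ?_
    rw [intervalIntegral.integral_finsetSum fun l _ => (hc k l).intervalIntegrable _ _]
    refine Finset.sum_congr rfl fun l _ => ?_
    rw [intervalIntegral.integral_const_mul]
  refine (le_abs_self _).trans ?_
  rw [← Real.norm_eq_abs, ← Complex.norm_real, h2, Finset.mul_sum]
  refine norm_sum_le_of_le _ fun k hk => ?_
  rw [Finset.mul_sum]
  refine norm_sum_le_of_le _ fun l hl => ?_
  rw [norm_mul, norm_mul, RCLike.norm_conj]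
  refine mul_le_mul_of_nonneg_right ?_ (norm_nonneg _)
  rw [sq]
  exact mul_le_mul (hd k hk) (hd l hl) (norm_nonneg _) ((norm_nonneg _).trans (hd k hk))

/-- A double large sieve: sampling an exponential sum of small bandwidth at well spaced points. -/
theorem large_sieve {ι β : Type*} (s : Finset ι) (v : ι → ℝ) (c : ι → ℂ) (u : Finset β)
    (y : β → ℝ) {η T : ℝ} (hη : 0 < η) (hT0 : 0 ≤ T) (hc : ∀ k ∈ s, ‖c k‖ ≤ 1)
    (hv : ∀ k ∈ s, 0 < v k) (hvη : ∀ k ∈ s, v k * η ≤ 1 / 4)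
    (hsep : ∀ b ∈ u, ∀ b' ∈ u, b ≠ b' → 2 * η ≤ |y b - y b'|)
    (hT : ∀ b ∈ u, |y b| + η ≤ T) :
    ∑ b ∈ u, ‖∑ k ∈ s, c k * expi (v k * y b)‖ ^ 2 ≤
      2 / η * ∑ k ∈ s, ∑ l ∈ s, ‖∫ t in (-T)..T, expi ((v k - v l) * t)‖ := by
  set J : ι → ℂ := fun k => ∫ t in (-η)..η, expi (v k * t) with hJ
  have hJη : ∀ k ∈ s, η ≤ ‖J k‖ := fun k hk => le_norm_integral_expi (hv k hk) hη (hvη k hk)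
  have hJ0 : ∀ k ∈ s, J k ≠ 0 := fun k hk => norm_pos_iff.mp (hη.trans_le (hJη k hk))
  -- Dividing the coefficients by `J k` makes the value of the original sum at `y` equal to the
  -- integral of `g` over the window around `y`; point values become integrals at the cost of a
  -- factor `1 / η` in the coefficients.
  set g : ℝ → ℂ := fun t => ∑ k ∈ s, (c k / J k) * expi (v k * t) with hg
  have hterm : ∀ k, Continuous fun t : ℝ => (c k / J k) * expi (v k * t) := fun k =>
    continuous_const.mul (continuous_expi.comp (continuous_const.mul continuous_id))
  have hgc : Continuous g := continuous_finsetSum _ fun k _ => hterm k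
  have hrep : ∀ y : ℝ, ∑ k ∈ s, c k * expi (v k * y) = ∫ t in (y - η)..(y + η), g t := by
    intro y
    rw [hg, intervalIntegral.integral_finsetSum fun k _ => (hterm k).intervalIntegrable _ _]
    refine Finset.sum_congr rfl fun k hk => ?_
    rw [intervalIntegral.integral_const_mul, integral_expi_translate]
    change _ = c k / J k * (expi (v k * y) * J k)
    field_simp [hJ0 k hk]
  have hstep : ∀ b ∈ u, ‖∑ k ∈ s, c k * expi (v k * y b)‖ ^ 2 ≤
      2 * η * ∫ t in (y b - η)..(y b + η), ‖g t‖ ^ 2 := by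
    intro b _
    rw [hrep]
    have := norm_integral_sq_le hgc (a := y b - η) (b := y b + η) (by linarith)
    rwa [show y b + η - (y b - η) = 2 * η by ring] at this
  have hd : ∀ k ∈ s, ‖c k / J k‖ ≤ 1 / η := by
    intro k hk
    rw [norm_div]
    exact div_le_div₀ zero_le_one (hc k hk) hη (hJη k hk)
  calc _ ≤ ∑ b ∈ u, 2 * η * ∫ t in (y b - η)..(y b + η), ‖g t‖ ^ 2 := Finset.sum_le_sum hstep
    _ = 2 * η * ∑ b ∈ u, ∫ t in (y b - η)..(y b + η), ‖g t‖ ^ 2 := by rw [Finset.mul_sum]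
    _ ≤ 2 * η * ∫ t in (-T)..T, ‖g t‖ ^ 2 := by
        gcongr
        exact sum_integral_le_of_spaced (hgc.norm.pow 2) (fun t => sq_nonneg _) u y hη hsep hT hT0
    _ ≤ 2 * η * ((1 / η) ^ 2 * ∑ k ∈ s, ∑ l ∈ s, ‖∫ t in (-T)..T, expi ((v k - v l) * t)‖) := by
        gcongr
        exact integral_norm_sq_sum_expi_le s v _ hd T
    _ = _ := by
        field_simp

/-! ### Differences of fractions and the bilinear exponential sum -/

lemma sum_Icc_inv_max_natAbs_le (R : ℕ) :
    ∑ d ∈ Icc (-(R : ℤ)) R, 1 / max 1 |(d : ℝ)| ≤ 1 + 2 * (harmonic R : ℝ) := by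
  induction R with
  | zero => simp
  | succ R ih =>
    have h : Icc (-((R + 1 : ℕ) : ℤ)) ((R + 1 : ℕ) : ℤ) =
        insert (-((R : ℤ) + 1)) (insert ((R : ℤ) + 1) (Icc (-(R : ℤ)) R)) := by
      ext d
      simp only [mem_Icc, mem_insert]
      omega
    rw [h, Finset.sum_insert (by simp only [mem_insert, mem_Icc]; omega),
      Finset.sum_insert (by simp only [mem_Icc]; omega), harmonic_succ]
    have hR : (0 : ℝ) ≤ R := Nat.cast_nonneg R
    have e1 : max 1 |((-((R : ℤ) + 1) : ℤ) : ℝ)| = R + 1 := by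
      push_cast
      rw [abs_neg, abs_of_nonneg (by linarith), max_eq_right (by linarith)]
    have e2 : max 1 |(((R : ℤ) + 1 : ℤ) : ℝ)| = R + 1 := by
      push_cast
      rw [abs_of_nonneg (by linarith), max_eq_right (by linarith)]
    rw [e1, e2]
    push_cast
    rw [one_div]
    linarith

lemma sum_inv_max_abs_le {ι : Type*} (s : Finset ι) (D : ι → ℤ) (hD : Set.InjOn D s) (R : ℕ)
    (hR : ∀ k ∈ s, |D k| ≤ R) :
    ∑ k ∈ s, 1 / max 1 |(D k : ℝ)| ≤ 3 + 2 * Real.log R := by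
  have h1 : ∑ k ∈ s, 1 / max 1 |(D k : ℝ)| = ∑ d ∈ s.image D, 1 / max 1 |(d : ℝ)| :=
    (Finset.sum_image (f := fun d : ℤ => 1 / max 1 |(d : ℝ)|) hD).symm
  have h2 : s.image D ⊆ Icc (-(R : ℤ)) R := by
    intro d hd
    obtain ⟨k, hk, rfl⟩ := Finset.mem_image.mp hd
    exact Finset.mem_Icc.mpr (abs_le.mp (hR k hk))
  have h3 := harmonic_le_one_add_log R
  have h4 := sum_Icc_inv_max_natAbs_le R
  rw [h1]
  have h5 := Finset.sum_le_sum_of_subset_of_nonneg h2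
    (f := fun d : ℤ => 1 / max 1 |(d : ℝ)|) fun d _ _ => by positivity
  linarith

/-- For a fixed fraction `h / a` with prime denominator, the determinant with `h' / a'` determines
`h' / a'` among the denominators in a dyadic range. -/
lemma injOn_det {A : Finset ℕ} {M : ℝ} (hA : ∀ a ∈ A, a.Prime ∧ M < a ∧ (a : ℝ) ≤ 2 * M) {K : ℕ}
    (hK : 2 * (K : ℝ) ≤ M) {h a : ℕ} (hh : h ∈ Ioo 0 (2 * K)) (ha : a ∈ A) :
    Set.InjOn (fun k : ℕ × ℕ => (h : ℤ) * k.2 - k.1 * a) (Ioo 0 (2 * K) ×ˢ A : Finset (ℕ × ℕ)) := by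
  rintro ⟨h₁, a₁⟩ hk₁ ⟨h₂, a₂⟩ hk₂ heq
  simp only [coe_product, Set.mem_prod, mem_coe, mem_Ioo] at hk₁ hk₂ heq hh
  obtain ⟨hp, haM, -⟩ := hA a ha
  obtain ⟨-, h1, h1'⟩ := hA a₁ hk₁.2
  obtain ⟨-, h2, h2'⟩ := hA a₂ hk₂.2
  have hKa : 2 * K < a := by
    have : (2 * (K : ℝ)) < a := by linarith
    exact_mod_cast this
  -- Equal determinants force `a ∣ h (a₁ - a₂)`, while `0 < h < a` and `|a₁ - a₂| < a` with `a`
  -- prime.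
  have hd : (a : ℤ) ∣ h * ((a₁ : ℤ) - a₂) := ⟨h₁ - h₂, by linarith⟩
  have hpi : Prime (a : ℤ) := Nat.prime_iff_prime_int.mp hp
  have hnd : ¬ (a : ℤ) ∣ h := by
    intro hc
    have := Nat.le_of_dvd hh.1 (Int.natCast_dvd_natCast.mp hc)
    omega
  have hd' := (hpi.dvd_or_dvd hd).resolve_left hnd
  have hlt : |(a₁ : ℤ) - a₂| < a := by
    have : |(a₁ : ℝ) - a₂| < a := by rw [abs_lt]; constructor <;> linarith
    exact_mod_cast this
  have h0 : (a₁ : ℤ) - a₂ = 0 := Int.eq_zero_of_abs_lt_dvd hd' hlt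
  have ha12 : a₁ = a₂ := by omega
  subst ha12
  have ha0 : (a : ℤ) ≠ 0 := hpi.ne_zero
  have : (h₁ : ℤ) = h₂ := mul_right_cancel₀ ha0 (by linarith)
  simp only [Prod.mk.injEq, and_true]
  exact_mod_cast this

/-- Two fractions differ by `D / (a a')` with `D` the integer determinant. The trivial bound serves
`D = 0` and the oscillation bound the rest; the `max` merges both. -/
lemma norm_integral_expi_frac_le {M : ℝ} {a a' h h' : ℕ} (hM : 0 < M) (ha : M < a)
    (ha2 : (a : ℝ) ≤ 2 * M) (ha' : M < a') (ha2' : (a' : ℝ) ≤ 2 * M) :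
    ‖∫ t in (-(2 * M ^ 2))..(2 * M ^ 2), expi (((h : ℝ) / a - (h' : ℝ) / a') * t)‖ ≤
      4 * M ^ 2 * (1 / max 1 |(((h : ℤ) * a' - h' * a : ℤ) : ℝ)|) := by
  have hap : (0 : ℝ) < a := hM.trans ha
  have hap' : (0 : ℝ) < a' := hM.trans ha'
  set D : ℤ := (h : ℤ) * a' - h' * a with hD
  have hfrac : (h : ℝ) / a - (h' : ℝ) / a' = D / (a * a') := by
    rw [hD]
    push_cast
    field_simp
  by_cases h0 : D = 0
  · rw [h0]
    refine (norm_integral_expi_le (by positivity) _).trans (le_of_eq ?_)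
    simp
    ring
  · have hDabs : (1 : ℝ) ≤ |(D : ℝ)| := by exact_mod_cast Int.one_le_abs h0
    have hDr : (D : ℝ) ≠ 0 := by exact_mod_cast h0
    rw [hfrac, max_eq_right hDabs]
    refine (norm_integral_expi_le_inv (div_ne_zero hDr (by positivity)) _).trans ?_
    rw [abs_div, abs_of_pos (show (0 : ℝ) < a * a' by positivity), one_div_div, mul_one_div]
    exact div_le_div_of_nonneg_right (by nlinarith) (abs_nonneg _)

/-- The mean square over `b` of the exponential sum with frequencies `h / a` at `x / b`. -/
lemma sum_norm_sq_le {A : Finset ℕ} {M x : ℝ} (hM : 0 < M)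
    (hA : ∀ a ∈ A, a.Prime ∧ M < a ∧ (a : ℝ) ≤ 2 * M) {K : ℕ} (hK8 : 8 ≤ K)
    (hK : 2 * (K : ℝ) ≤ M) (hx1 : M ^ 3 / 8 ≤ x) (hx2 : x ≤ M ^ 3) (γ : ℕ → ℂ)
    (hγ : ∀ h, ‖γ h‖ ≤ 1) :
    ∑ b ∈ A, ‖∑ k ∈ Ioo 0 (2 * K) ×ˢ A, γ k.1 * expi ((k.1 : ℝ) / k.2 * (x / b))‖ ^ 2 ≤
      128 * K ^ 2 * M * #A * (3 + 2 * Real.log (4 * K * M)) := by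
  have hK0 : (8 : ℝ) ≤ K := by exact_mod_cast hK8
  have hKpos : (0 : ℝ) < K := by linarith
  have hx0 : 0 < x := lt_of_lt_of_le (by positivity) hx1
  -- Frequencies are at most `2K / M`, so this `η` is the largest for which `v η ≤ 1/4` follows from
  -- that bound. Points are at most `M ^ 2`, which leaves room for `η` in `T`.
  have hls := large_sieve (Ioo 0 (2 * K) ×ˢ A) (fun k : ℕ × ℕ => (k.1 : ℝ) / k.2)
    (fun k => γ k.1) A (fun b => x / b) (η := M / (8 * K)) (T := 2 * M ^ 2) (by positivity)
    (by positivity) (fun k _ => hγ _) ?_ ?_ ?_ ?_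
  · refine hls.trans ?_
    have hrow : ∀ k ∈ Ioo 0 (2 * K) ×ˢ A, ∑ l ∈ Ioo 0 (2 * K) ×ˢ A,
        ‖∫ t in (-(2 * M ^ 2))..(2 * M ^ 2), expi (((k.1 : ℝ) / k.2 - (l.1 : ℝ) / l.2) * t)‖ ≤
        4 * M ^ 2 * (3 + 2 * Real.log (4 * K * M)) := by
      intro k hk
      obtain ⟨hk1, hk2⟩ := Finset.mem_product.mp hk
      obtain ⟨-, ha, ha2⟩ := hA _ hk2
      refine (Finset.sum_le_sum (g := fun l : ℕ × ℕ => 4 * M ^ 2 *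
        (1 / max 1 |(((k.1 : ℤ) * l.2 - l.1 * k.2 : ℤ) : ℝ)|)) fun l hl => ?_).trans ?_
      · obtain ⟨hl1, hl2⟩ := Finset.mem_product.mp hl
        obtain ⟨-, hb, hb2⟩ := hA _ hl2
        exact norm_integral_expi_frac_le hM ha ha2 hb hb2
      · rw [← Finset.mul_sum]
        refine mul_le_mul_of_nonneg_left ?_ (by positivity)
        refine (sum_inv_max_abs_le _ _ (injOn_det hA hK hk1 hk2) ⌊4 * K * M⌋₊ ?_).trans ?_
        · intro l hl
          obtain ⟨hl1, hl2⟩ := Finset.mem_product.mp hl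
          obtain ⟨-, hb, hb2⟩ := hA _ hl2
          rw [Finset.mem_Ioo] at hk1 hl1
          have b1 : ((k.1 * l.2 : ℕ) : ℝ) ≤ 4 * K * M := by
            have : (k.1 : ℝ) ≤ 2 * K := by exact_mod_cast hk1.2.le
            push_cast
            nlinarith [(Nat.cast_nonneg k.1 : (0 : ℝ) ≤ k.1), (Nat.cast_nonneg l.2 : (0 : ℝ) ≤ l.2)]
          have b2 : ((l.1 * k.2 : ℕ) : ℝ) ≤ 4 * K * M := by
            have : (l.1 : ℝ) ≤ 2 * K := by exact_mod_cast hl1.2.le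
            push_cast
            nlinarith [(Nat.cast_nonneg l.1 : (0 : ℝ) ≤ l.1), (Nat.cast_nonneg k.2 : (0 : ℝ) ≤ k.2)]
          have c1 := Nat.le_floor b1
          have c2 := Nat.le_floor b2
          generalize ⌊4 * (K : ℝ) * M⌋₊ = R at c1 c2
          zify at c1 c2
          have p1 : (0 : ℤ) ≤ k.1 * l.2 := by positivity
          have p2 : (0 : ℤ) ≤ l.1 * k.2 := by positivity
          rw [abs_le]
          constructor <;> linarith
        · have hfl : ((⌊4 * (K : ℝ) * M⌋₊ : ℕ) : ℝ) ≤ 4 * K * M := Nat.floor_le (by positivity)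
          have hfl0 : (0 : ℝ) < (⌊4 * (K : ℝ) * M⌋₊ : ℕ) := by
            have : 0 < ⌊4 * (K : ℝ) * M⌋₊ := Nat.floor_pos.mpr (by nlinarith)
            exact_mod_cast this
          have := Real.log_le_log hfl0 hfl
          linarith
    have hsum := Finset.sum_le_card_nsmul _ _ _ hrow
    rw [nsmul_eq_mul] at hsum
    have hcard : ((#(Ioo 0 (2 * K) ×ˢ A) : ℕ) : ℝ) ≤ 2 * K * #A := by
      rw [Finset.card_product, Nat.card_Ioo]
      push_cast
      gcongr
      have : 2 * K - 0 - 1 ≤ 2 * K := by omega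
      exact_mod_cast this
    have hL : 0 ≤ 3 + 2 * Real.log (4 * K * M) := by
      have := Real.log_nonneg (show 1 ≤ 4 * (K : ℝ) * M by nlinarith)
      linarith
    calc _ ≤ 2 / (M / (8 * K)) * ((2 * K * #A) * (4 * M ^ 2 * (3 + 2 * Real.log (4 * K * M)))) := by
          refine mul_le_mul_of_nonneg_left (hsum.trans ?_) (by positivity)
          exact mul_le_mul_of_nonneg_right hcard (by positivity)
      _ = _ := by
          field_simp
          ring
  · intro k hk
    obtain ⟨hk1, hk2⟩ := Finset.mem_product.mp hk
    have := (hA _ hk2).1.pos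
    have := (Finset.mem_Ioo.mp hk1).1
    positivity
  · intro k hk
    obtain ⟨hk1, hk2⟩ := Finset.mem_product.mp hk
    obtain ⟨-, ha, ha2⟩ := hA _ hk2
    have ha0 : (0 : ℝ) < k.2 := hM.trans ha
    have : (k.1 : ℝ) ≤ 2 * K := by exact_mod_cast (Finset.mem_Ioo.mp hk1).2.le
    rw [div_mul_div_comm, div_le_div_iff₀ (by positivity) (by norm_num)]
    nlinarith [mul_le_mul this ha.le hM.le (by positivity)]
  · intro b hb b' hb' hne
    obtain ⟨-, h1, h2⟩ := hA _ hb
    obtain ⟨-, h1', h2'⟩ := hA _ hb'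
    have hb0 : (0 : ℝ) < b := hM.trans h1
    have hb0' : (0 : ℝ) < b' := hM.trans h1'
    have hdiff : (1 : ℝ) ≤ |(b' : ℝ) - b| := by
      have : (1 : ℤ) ≤ |(b' : ℤ) - b| := Int.one_le_abs (by omega)
      exact_mod_cast this
    have e : x / b - x / b' = x * (b' - b) / (b * b') := by field_simp
    rw [e, abs_div, abs_mul, abs_of_pos hx0, abs_of_pos (mul_pos hb0 hb0')]
    -- Distinct `b` give points at least `x / (4 M ^ 2) ≥ M / 32` apart; `K ≥ 8` makes this at least
    -- `2η = M / (4K)`.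
    calc 2 * (M / (8 * K)) ≤ x / (4 * M ^ 2) := by
          rw [le_div_iff₀ (by positivity)]
          have : 2 * (M / (8 * K)) * (4 * M ^ 2) = M ^ 3 / K := by field_simp; ring
          rw [this]
          refine le_trans ?_ hx1
          gcongr
      _ ≤ x * |(b' : ℝ) - b| / (b * b') := by
          refine div_le_div₀ (by positivity) (by nlinarith) (by positivity) ?_
          nlinarith
  · intro b hb
    obtain ⟨-, h1, h2⟩ := hA _ hb
    have hb0 : (0 : ℝ) < b := hM.trans h1
    rw [abs_of_pos (by positivity)]
    have t1 : x / b ≤ M ^ 2 := by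
      rw [div_le_iff₀ hb0]
      nlinarith [sq_nonneg M, mul_le_mul_of_nonneg_left h1.le (sq_nonneg M)]
    have t2 : M / (8 * K) ≤ M ^ 2 := by
      rw [div_le_iff₀ (by positivity)]
      nlinarith [mul_pos hM hKpos, mul_pos (mul_pos hM hM) hKpos]
    linarith

/-- Cancellation in the bilinear sums `∑ e (h x / (a b))` on average over `h`. -/
theorem sum_norm_bilinear_sq_le {A : Finset ℕ} {M x : ℝ} (hM : 0 < M)
    (hA : ∀ a ∈ A, a.Prime ∧ M < a ∧ (a : ℝ) ≤ 2 * M) {K : ℕ} (hK8 : 8 ≤ K)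
    (hK : 2 * (K : ℝ) ≤ M) (hx1 : M ^ 3 / 8 ≤ x) (hx2 : x ≤ M ^ 3) :
    (∑ h ∈ Ioo 0 (2 * K), ‖∑ a ∈ A, ∑ b ∈ A, expi (h * (x / (a * b)))‖) ^ 2 ≤
      128 * K ^ 2 * M * #A ^ 2 * (3 + 2 * Real.log (4 * K * M)) := by
  set S : ℕ → ℂ := fun h => ∑ a ∈ A, ∑ b ∈ A, expi (h * (x / (a * b))) with hS
  -- Conjugate phases turn the sum of norms into a single linear form; if `S h = 0`, division by
  -- zero gives `γ h = 0`, which is harmless.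
  set γ : ℕ → ℂ := fun h => (starRingEnd ℂ) (S h) / ‖S h‖ with hγ
  have hγ1 : ∀ h, ‖γ h‖ ≤ 1 := by
    intro h
    rw [hγ]
    simp only [norm_div, RCLike.norm_conj, Complex.norm_real, norm_norm]
    exact div_self_le_one _
  have hγS : ∀ h, γ h * S h = (‖S h‖ : ℂ) := by
    intro h
    by_cases h0 : S h = 0
    · simp [h0]
    · have : (‖S h‖ : ℂ) ≠ 0 := by exact_mod_cast norm_ne_zero_iff.mpr h0
      rw [hγ]
      simp only
      rw [div_mul_eq_mul_div, Complex.conj_mul', sq, mul_div_assoc, div_self this, mul_one]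
  have hB : ((∑ h ∈ Ioo 0 (2 * K), ‖S h‖ : ℝ) : ℂ) =
      ∑ b ∈ A, ∑ k ∈ Ioo 0 (2 * K) ×ˢ A, γ k.1 * expi ((k.1 : ℝ) / k.2 * (x / b)) := by
    push_cast
    simp_rw [← hγS, Finset.sum_product, hS]
    rw [Finset.sum_comm]
    refine Finset.sum_congr rfl fun h _ => ?_
    rw [Finset.sum_comm, Finset.mul_sum]
    rw [Finset.sum_comm (s := A) (t := A)]
    simp_rw [Finset.mul_sum]
    refine Finset.sum_congr rfl fun a _ => Finset.sum_congr rfl fun b _ => ?_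
    congr 2
    rw [div_mul_div_comm, mul_div_assoc, mul_comm (b : ℝ)]
  have hB' : ∑ h ∈ Ioo 0 (2 * K), ‖S h‖ ≤
      ∑ b ∈ A, ‖∑ k ∈ Ioo 0 (2 * K) ×ˢ A, γ k.1 * expi ((k.1 : ℝ) / k.2 * (x / b))‖ := by
    refine (le_abs_self _).trans ?_
    rw [← Real.norm_eq_abs, ← Complex.norm_real, hB]
    exact norm_sum_le _ _
  have hB0 : 0 ≤ ∑ h ∈ Ioo 0 (2 * K), ‖S h‖ := Finset.sum_nonneg fun _ _ => norm_nonneg _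
  calc _ ≤ (∑ b ∈ A,
        ‖∑ k ∈ Ioo 0 (2 * K) ×ˢ A, γ k.1 * expi ((k.1 : ℝ) / k.2 * (x / b))‖) ^ 2 :=
        pow_le_pow_left₀ hB0 hB' 2
    _ ≤ #A * ∑ b ∈ A,
        ‖∑ k ∈ Ioo 0 (2 * K) ×ˢ A, γ k.1 * expi ((k.1 : ℝ) / k.2 * (x / b))‖ ^ 2 :=
        sq_sum_le_card_mul_sum_sq
    _ ≤ #A * (128 * K ^ 2 * M * #A * (3 + 2 * Real.log (4 * K * M))) := by
        gcongr
        exact sum_norm_sq_le hM hA hK8 hK hx1 hx2 γ hγ1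
    _ = _ := by ring

/-! ### Fourth moments of Dirichlet kernels -/

lemma four_mul_le_norm_expi_sub_one {φ δ : ℝ} (h : ∀ m : ℤ, δ ≤ |φ - m|) :
    4 * δ ≤ ‖expi φ - 1‖ := by
  set r := φ - round φ with hr
  have hr2 : |r| ≤ 1 / 2 := abs_sub_round φ
  have h1 : expi φ = expi r := by
    rw [show φ = r + round φ by rw [hr]; ring, expi_add, expi_int, mul_one]
  have h2 : ‖expi r - 1‖ = 2 * |Real.sin (Real.pi * r)| := by
    unfold expi
    rw [mul_comm, Complex.norm_exp_I_mul_ofReal_sub_one, norm_mul, Real.norm_eq_abs,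
      Real.norm_eq_abs, abs_two, show 2 * Real.pi * r / 2 = Real.pi * r by ring]
  have hpi := Real.pi_pos
  have h3 : |Real.pi * r| ≤ Real.pi / 2 := by
    rw [abs_mul, abs_of_pos hpi]
    nlinarith
  have h4 := Real.mul_abs_le_abs_sin h3
  rw [abs_mul, abs_of_pos hpi, ← mul_assoc, div_mul_cancel₀ _ hpi.ne'] at h4
  have h5 := h (round φ)
  rw [← hr] at h5
  rw [h1, h2]
  linarith

lemma norm_sum_expi_le {φ δ : ℝ} (hδ : 0 < δ) (h : ∀ m : ℤ, δ ≤ |φ - m|) (K : ℕ) :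
    ‖∑ k ∈ range K, expi (k * φ)‖ ≤ 1 / (2 * δ) := by
  have h1 := four_mul_le_norm_expi_sub_one h
  have h0 : expi φ ≠ 1 := by
    intro hc
    rw [hc, sub_self, norm_zero] at h1
    linarith
  simp_rw [expi_natCast_mul]
  rw [geom_sum_eq h0, norm_div]
  have h2 : ‖expi φ ^ K - 1‖ ≤ 2 := by
    refine (norm_sub_le _ _).trans ?_
    rw [norm_pow, norm_expi, one_pow, norm_one]
    norm_num
  calc _ ≤ 2 / (4 * δ) := div_le_div₀ (by norm_num) h2 (by linarith) h1
    _ = _ := by field_simp; norm_num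

/-- The quadruples `((k₁, k₃), (k₂, k₄))` of naturals below `K`. -/
def quadruples (K : ℕ) : Finset ((ℕ × ℕ) × ℕ × ℕ) := (range K ×ˢ range K) ×ˢ range K ×ˢ range K

/-- The additive defect `k₁ + k₂ - k₃ - k₄` of a quadruple. -/
def defect (q : (ℕ × ℕ) × ℕ × ℕ) : ℤ := (q.1.1 : ℤ) + q.2.1 - q.1.2 - q.2.2

/-- The count is the additive energy of `range K`. Cauchy–Schwarz bounds it below by `K ^ 4` over
the size of the sumset, which is at most `2K`. -/
lemma cube_le_card_defect_eq_zero (K : ℕ) :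
    (K : ℝ) ^ 3 ≤ 2 * #{q ∈ quadruples K | defect q = 0} := by
  rcases Nat.eq_zero_or_pos K with rfl | hK
  · simp
  have h1 := Finset.le_card_add_mul_addEnergy (range K) (range K)
  open scoped Pointwise in
  have h2 : #(range K + range K) ≤ 2 * K := by
    refine (Finset.card_le_card (t := range (2 * K)) ?_).trans (by simp)
    intro n hn
    obtain ⟨i, hi, j, hj, rfl⟩ := Finset.mem_add.mp hn
    rw [Finset.mem_range] at *
    omega
  have h3 : Finset.addEnergy (range K) (range K) = #{q ∈ quadruples K | defect q = 0} := by
    unfold Finset.addEnergy quadruples defect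
    congr 1
    refine Finset.filter_congr fun q _ => ?_
    omega
  rw [h3, card_range] at h1
  have h4 := h1.trans (Nat.mul_le_mul_right _ h2)
  have h5 : K ^ 3 ≤ 2 * #{q ∈ quadruples K | defect q = 0} := by
    refine Nat.le_of_mul_le_mul_left ?_ hK
    calc _ = K ^ 2 * K ^ 2 := by ring
      _ ≤ _ := h4
      _ = _ := by ring
  exact_mod_cast h5

/-- With three coordinates fixed, the defect is injective in the fourth, so each absolute value
arises at most once per sign; hence the factor 2. -/
lemma sum_defect_ne_zero_le (K : ℕ) (W : ℕ → ℝ) (hW : ∀ h, 0 ≤ W h) :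
    ∑ q ∈ quadruples K with defect q ≠ 0, W (defect q).natAbs ≤
      2 * K ^ 3 * ∑ h ∈ Ioo 0 (2 * K), W h := by
  have key : ∀ p : ℕ × ℕ, p.1 < K → p.2 < K → ∀ k < K, ∑ l ∈ range K,
      (if defect (p, k, l) ≠ 0 then W (defect (p, k, l)).natAbs else 0) ≤
      2 * ∑ h ∈ Ioo 0 (2 * K), W h := by
    intro p hp1 hp2 k hk
    have split : ∀ l ∈ range K,
        (if defect (p, k, l) ≠ 0 then W (defect (p, k, l)).natAbs else 0) =
        (if 0 < defect (p, k, l) then W (defect (p, k, l)).natAbs else 0) +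
        (if defect (p, k, l) < 0 then W (defect (p, k, l)).natAbs else 0) := by
      intro l _
      rcases lt_trichotomy (defect (p, k, l)) 0 with h | h | h
      · simp [h, h.ne, h.le]
      · simp [h]
      · simp [h, h.ne', h.le]
    rw [Finset.sum_congr rfl split, Finset.sum_add_distrib, two_mul,
      ← Finset.sum_filter, ← Finset.sum_filter]
    refine add_le_add ?_ ?_
    all_goals
      rw [← Finset.sum_image (f := W) (g := fun l => (defect (p, k, l)).natAbs)]
      · refine Finset.sum_le_sum_of_subset_of_nonneg ?_ fun h _ _ => hW h
        intro h hh
        obtain ⟨l, hl, rfl⟩ := Finset.mem_image.mp hh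
        obtain ⟨hl1, hl2⟩ := Finset.mem_filter.mp hl
        simp only [mem_range, defect, mem_Ioo] at hl1 hl2 ⊢
        omega
      · intro l hl l' hl' heq
        have hl1 := (Finset.mem_filter.mp (Finset.mem_coe.mp hl)).2
        have hl2 := (Finset.mem_filter.mp (Finset.mem_coe.mp hl')).2
        simp only [defect] at hl1 hl2 heq
        omega
  rw [Finset.sum_filter, quadruples, Finset.sum_product]
  simp_rw [Finset.sum_product]
  set B := ∑ h ∈ Ioo 0 (2 * K), W h
  calc _ ≤ ∑ i ∈ range K, ∑ j ∈ range K, ∑ k ∈ range K, 2 * B := by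
        refine Finset.sum_le_sum fun i hi => Finset.sum_le_sum fun j hj =>
          Finset.sum_le_sum fun k hk => ?_
        exact key (i, j) (mem_range.mp hi) (mem_range.mp hj) k (mem_range.mp hk)
    _ = _ := by
        simp only [sum_const, card_range, nsmul_eq_mul]
        ring

lemma norm_sum_expi_pow_four (K : ℕ) (φ : ℝ) :
    ((‖∑ k ∈ range K, expi (k * φ)‖ ^ 4 : ℝ) : ℂ) = ∑ q ∈ quadruples K, expi (defect q * φ) := by
  set D := ∑ k ∈ range K, expi (k * φ) with hD
  have h1 : ((‖D‖ ^ 4 : ℝ) : ℂ) = (D * (starRingEnd ℂ) D) * (D * (starRingEnd ℂ) D) := by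
    rw [Complex.mul_conj']
    push_cast
    ring
  have h2 : D * (starRingEnd ℂ) D =
      ∑ p ∈ range K ×ˢ range K, expi (((p.1 : ℝ) - p.2) * φ) := by
    rw [Finset.sum_product, hD, map_sum, Finset.sum_mul_sum]
    refine Finset.sum_congr rfl fun i _ => Finset.sum_congr rfl fun j _ => ?_
    rw [conj_expi, ← expi_add]
    ring_nf
  rw [h1, h2, Finset.sum_mul_sum, quadruples]
  conv_rhs => rw [Finset.sum_product]
  refine Finset.sum_congr rfl fun p _ => Finset.sum_congr rfl fun r _ => ?_
  rw [← expi_add, defect]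
  push_cast
  ring_nf

/-- If finitely many reals all stay away from the integers then some of their low-frequency
exponential sums are large. -/
theorem exponential_sums_large {ι : Type*} (s : Finset ι) (φ : ι → ℝ) {δ : ℝ} (hδ : 0 < δ)
    (h : ∀ k ∈ s, ∀ m : ℤ, δ ≤ |φ k - m|) (K : ℕ) :
    (K : ℝ) ^ 3 / 2 * #s ≤ #s / (16 * δ ^ 4) +
      2 * K ^ 3 * ∑ j ∈ Ioo 0 (2 * K), ‖∑ k ∈ s, expi (j * φ k)‖ := by
  set W : ℕ → ℝ := fun j => ‖∑ k ∈ s, expi (j * φ k)‖ with hW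
  have hWabs : ∀ j : ℤ, ‖∑ k ∈ s, expi (j * φ k)‖ = W j.natAbs := by
    intro j
    rcases Int.natAbs_eq j with hj | hj
    · rw [hW]
      simp only
      congr 2
      ext k
      conv_lhs => rw [hj]
      simp
    · rw [hW]
      simp only
      rw [← RCLike.norm_conj, map_sum]
      congr 2
      ext k
      rw [conj_expi]
      conv_lhs => rw [hj]
      simp
  have hup : ∑ k ∈ s, ‖∑ j ∈ range K, expi (j * φ k)‖ ^ 4 ≤ #s / (16 * δ ^ 4) := by
    have : ∀ k ∈ s, ‖∑ j ∈ range K, expi (j * φ k)‖ ^ 4 ≤ 1 / (16 * δ ^ 4) := by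
      intro k hk
      refine (pow_le_pow_left₀ (norm_nonneg _) (norm_sum_expi_le hδ (h k hk) K) 4).trans
        (le_of_eq ?_)
      rw [div_pow, mul_pow]
      norm_num
    refine (Finset.sum_le_card_nsmul _ _ _ this).trans (le_of_eq ?_)
    rw [nsmul_eq_mul, mul_one_div]
  have hexp : ((∑ k ∈ s, ‖∑ j ∈ range K, expi (j * φ k)‖ ^ 4 : ℝ) : ℂ) =
      ((#{q ∈ quadruples K | defect q = 0} * #s : ℝ) : ℂ) +
        ∑ q ∈ quadruples K with defect q ≠ 0, ∑ k ∈ s, expi (defect q * φ k) := by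
    rw [Complex.ofReal_sum]
    simp_rw [norm_sum_expi_pow_four]
    rw [Finset.sum_comm, ← Finset.sum_filter_add_sum_filter_not _ (fun q => defect q = 0)]
    congr 1
    rw [Finset.sum_congr rfl (g := fun _ => (#s : ℂ))]
    · simp
    · intro q hq
      rw [(Finset.mem_filter.mp hq).2]
      simp
  have hlow : #{q ∈ quadruples K | defect q = 0} * (#s : ℝ) -
      ∑ q ∈ quadruples K with defect q ≠ 0, W (defect q).natAbs ≤
      ∑ k ∈ s, ‖∑ j ∈ range K, expi (j * φ k)‖ ^ 4 := by
    have hn : ‖∑ q ∈ quadruples K with defect q ≠ 0, ∑ k ∈ s, expi (defect q * φ k)‖ ≤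
        ∑ q ∈ quadruples K with defect q ≠ 0, W (defect q).natAbs :=
      norm_sum_le_of_le _ fun q _ => (hWabs _).le
    -- The fourth moment is real, so real parts separate the diagonal from an error bounded by its
    -- norm.
    have hre := congrArg Complex.re hexp
    rw [Complex.add_re, Complex.ofReal_re, Complex.ofReal_re] at hre
    have := (abs_le.mp (Complex.abs_re_le_norm
      (∑ q ∈ quadruples K with defect q ≠ 0, ∑ k ∈ s, expi (defect q * φ k)))).1
    linarith
  have hcount := cube_le_card_defect_eq_zero K
  have hoff := sum_defect_ne_zero_le K W fun j => norm_nonneg _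
  have hs : (0 : ℝ) ≤ #s := Nat.cast_nonneg _
  nlinarith

/-! ### Many primes in a dyadic interval -/

/-- The primes in the interval `(M, 2 M]`. -/
noncomputable def dyadicPrimes (M : ℝ) : Finset ℕ := {p ∈ Ioc ⌊M⌋₊ ⌊2 * M⌋₊ | p.Prime}

lemma mem_dyadicPrimes {M : ℝ} (hM : 0 ≤ M) {p : ℕ} (hp : p ∈ dyadicPrimes M) :
    p.Prime ∧ M < p ∧ (p : ℝ) ≤ 2 * M := by
  obtain ⟨h1, h2⟩ := Finset.mem_filter.mp hp
  obtain ⟨h3, h4⟩ := Finset.mem_Ioc.mp h1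
  exact ⟨h2, (Nat.floor_lt hM).mp h3, (Nat.le_floor_iff (by linarith)).mp h4⟩

lemma theta_sub_theta_le {N : ℝ} (hN : 0 ≤ N) :
    Chebyshev.theta (2 * N) - Chebyshev.theta N ≤ #(dyadicPrimes N) * Real.log (2 * N) := by
  have hfl : ⌊N⌋₊ ≤ ⌊2 * N⌋₊ := Nat.floor_mono (by linarith)
  have h : Chebyshev.theta (2 * N) =
      Chebyshev.theta N + ∑ p ∈ dyadicPrimes N, Real.log p := by
    unfold Chebyshev.theta dyadicPrimes
    rw [← Finset.sum_union]
    · rw [← Finset.filter_union, Finset.Ioc_union_Ioc_eq_Ioc (Nat.zero_le _) hfl]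
    · refine Finset.disjoint_filter_filter ?_
      rw [Finset.disjoint_left]
      intro p h1 h2
      rw [Finset.mem_Ioc] at h1 h2
      omega
  rw [h, add_sub_cancel_left, ← nsmul_eq_mul]
  refine Finset.sum_le_card_nsmul _ _ _ fun p hp => ?_
  obtain ⟨h1, -, h2⟩ := mem_dyadicPrimes hN hp
  exact Real.log_le_log (by exact_mod_cast h1.pos) h2

/-- The Chebyshev bounds have main terms `x log 2` below and `2 x log 2` above, so they yield
nothing on `(N, 2N]`; on `(N, 4N]` they leave `2 N log 2 > N`. This is why the next choice is
between two dyadic intervals. -/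
lemma eventually_le_theta_sub_theta :
    ∀ᶠ N : ℝ in Filter.atTop, N ≤ Chebyshev.theta (4 * N) - Chebyshev.theta N := by
  have ho : ∀ᶠ y : ℝ in Filter.atTop, Real.log y ≤ 1 / 100 * y ^ (1 / 2 : ℝ) := by
    have := (isLittleO_log_rpow_atTop (show (0 : ℝ) < 1 / 2 by norm_num)).bound
      (show (0 : ℝ) < 1 / 100 by norm_num)
    filter_upwards [this, Filter.eventually_ge_atTop 1] with y hy h1
    rw [Real.norm_eq_abs, Real.norm_eq_abs, abs_of_nonneg (Real.log_nonneg h1),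
      abs_of_nonneg (by positivity)] at hy
    exact hy
  have h4 : Filter.Tendsto (fun N : ℝ => 4 * N) Filter.atTop Filter.atTop :=
    Filter.tendsto_id.const_mul_atTop (by norm_num)
  have h5 : Filter.Tendsto (fun N : ℝ => 4 * N + 2) Filter.atTop Filter.atTop :=
    Filter.tendsto_atTop_add_const_right _ _ h4
  filter_upwards [h4.eventually ho, h5.eventually ho, Filter.eventually_ge_atTop 100]
    with N h1 h2 hN
  have hlow := Chebyshev.theta_ge' (x := 4 * N) (by linarith)
  have hup := Chebyshev.theta_le_log4_mul_x (x := N) (by linarith)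
  rw [← Real.sqrt_eq_rpow] at h1 h2
  have hlog4 : Real.log 4 = 2 * Real.log 2 := by
    rw [show (4 : ℝ) = 2 ^ 2 by norm_num, Real.log_pow]
    norm_num
  have hl2 := Real.log_two_gt_d9
  have hl2' := Real.log_two_lt_d9
  have s1 : √(4 * N) * √(4 * N) = 4 * N := Real.mul_self_sqrt (by linarith)
  have s2 : √(4 * N + 2) ≤ 4 * N + 2 := 
    Real.sqrt_le_iff.mpr ⟨by linarith, by nlinarith⟩
  have s3 : √(4 * N) * Real.log (4 * N) ≤ 4 * N / 100 := by
    calc _ ≤ √(4 * N) * (1 / 100 * √(4 * N)) := by gcongr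
      _ = 1 / 100 * (√(4 * N) * √(4 * N)) := by ring
      _ = _ := by rw [s1]; ring
  rw [hlog4] at hup
  have s4 : 0.693 * N ≤ Real.log 2 * N := mul_le_mul_of_nonneg_right (by linarith) (by linarith)
  linarith

lemma eventually_card_dyadicPrimes :
    ∀ᶠ N : ℝ in Filter.atTop, ∃ M : ℝ, (M = N ∨ M = 2 * N) ∧
      M ≤ 4 * Real.log (4 * M) * #(dyadicPrimes M) := by
  filter_upwards [eventually_le_theta_sub_theta, Filter.eventually_ge_atTop 1] with N h hN
  have h1 := theta_sub_theta_le (N := N) (by linarith)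
  have h2 := theta_sub_theta_le (N := 2 * N) (by linarith)
  rw [← mul_assoc] at h2
  norm_num at h2
  have hl0 : 0 ≤ Real.log (2 * N) := Real.log_nonneg (by linarith)
  have hl1 : Real.log (2 * N) ≤ Real.log (4 * N) := Real.log_le_log (by linarith) (by linarith)
  have hl2 : Real.log (4 * N) ≤ Real.log (4 * (2 * N)) :=
    Real.log_le_log (by linarith) (by linarith)
  have p1 : (0 : ℝ) ≤ #(dyadicPrimes N) := Nat.cast_nonneg _
  have p2 : (0 : ℝ) ≤ #(dyadicPrimes (2 * N)) := Nat.cast_nonneg _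
  have q1 := mul_le_mul_of_nonneg_left hl1 p1
  have q2 := mul_le_mul_of_nonneg_left hl2 p2
  by_cases hc : N ≤ 4 * Real.log (4 * N) * #(dyadicPrimes N)
  · exact ⟨N, Or.inl rfl, hc⟩
  · refine ⟨2 * N, Or.inr rfl, ?_⟩
    push Not at hc
    nlinarith

/-! ### Choice of parameters and conclusion -/

lemma eventually_log_cube_lt :
    ∀ᶠ M : ℝ in Filter.atTop, 10 ^ 7 * Real.log (4 * M) ^ 3 < M ^ (1 / 9 : ℝ) := by
  have ho := (isLittleO_log_rpow_rpow_atTop 3 (show (0 : ℝ) < 1 / 9 by norm_num)).bound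
      (show (0 : ℝ) < 1 / (10 ^ 8) by norm_num)
  have h4 : Filter.Tendsto (fun N : ℝ => 4 * N) Filter.atTop Filter.atTop :=
    Filter.tendsto_id.const_mul_atTop (by norm_num)
  filter_upwards [h4.eventually ho, Filter.eventually_ge_atTop 1] with M h hM
  have hl0 : 0 ≤ Real.log (4 * M) := Real.log_nonneg (by linarith)
  rw [Real.norm_eq_abs, Real.norm_eq_abs, abs_of_nonneg (by positivity),
    abs_of_nonneg (by positivity), Real.mul_rpow (by norm_num) (by linarith)] at h
  have h9 : (4 : ℝ) ^ (1 / 9 : ℝ) ≤ 4 :=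
    (Real.rpow_le_rpow_of_exponent_le (by norm_num) (by norm_num)).trans (Real.rpow_one 4).le
  have hp : 0 < M ^ (1 / 9 : ℝ) := by positivity
  have e : Real.log (4 * M) ^ (3 : ℝ) = Real.log (4 * M) ^ 3 := by
    exact_mod_cast Real.rpow_natCast (Real.log (4 * M)) 3
  rw [e] at h
  nlinarith [mul_le_mul_of_nonneg_right h9 hp.le]

lemma rpow_four_ninths_sq_mul {M : ℝ} (hM : 0 < M) :
    (M ^ (4 / 9 : ℝ)) ^ 2 * M * M ^ (1 / 9 : ℝ) = M ^ 2 := by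
  have e1 : (M ^ (4 / 9 : ℝ)) ^ 2 = M ^ (8 / 9 : ℝ) := by
    rw [← Real.rpow_natCast, ← Real.rpow_mul hM.le]
    congr 1
    norm_num
  have e2 : M ^ (8 / 9 : ℝ) * M ^ (1 / 9 : ℝ) = M := by
    rw [← Real.rpow_add hM, show (8 / 9 + 1 / 9 : ℝ) = 1 by norm_num, Real.rpow_one]
  rw [e1, mul_right_comm, e2, sq]

/-- The bounds give `M ^ 2 ≪ M ^ (17/9) ℓ ^ 3`. The constant is `16 · 64 · 128 · 4 · 7 = 3670016 <
10 ^ 7`. -/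
lemma false_of_bounds {M K P ℓ : ℝ} (hM : 0 < M) (hℓ : 0 < ℓ) (hK0 : 0 ≤ K)
    (hK : K ≤ 2 * M ^ (4 / 9 : ℝ)) (hcard : M ≤ 4 * ℓ * P)
    (hP : P ^ 2 ≤ 64 * (128 * K ^ 2 * M * (7 * ℓ))) (hlog : 10 ^ 7 * ℓ ^ 3 < M ^ (1 / 9 : ℝ)) :
    False := by
  have hexp := rpow_four_ninths_sq_mul hM
  set Q := M ^ (4 / 9 : ℝ) with hQ
  have hQ0 : 0 < Q := by positivity
  have hfin : M ^ 2 ≤ 3670016 * (Q ^ 2 * M * ℓ ^ 3) := by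
    calc M ^ 2 ≤ (4 * ℓ * P) ^ 2 := pow_le_pow_left₀ hM.le hcard 2
      _ = 16 * ℓ ^ 2 * P ^ 2 := by ring
      _ ≤ 16 * ℓ ^ 2 * (64 * (128 * (2 * Q) ^ 2 * M * (7 * ℓ))) := by
          refine mul_le_mul_of_nonneg_left (hP.trans ?_) (by positivity)
          gcongr
      _ = 3670016 * (Q ^ 2 * M * ℓ ^ 3) := by ring
  have hcpos : 0 < Q ^ 2 * M := by positivity
  have h1 := mul_lt_mul_of_pos_left hlog hcpos
  rw [hexp] at h1
  have h2 : 0 ≤ Q ^ 2 * M * ℓ ^ 3 := by positivity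
  linarith

/-- Products of two primes near `M` divide some integer in a short interval near `M ^ 3`. -/
theorem exists_near_integer :
    ∃ M₀ : ℝ, ∀ M ≥ M₀, ∀ x δ : ℝ, M ^ 3 / 8 ≤ x → x ≤ M ^ 3 → M ^ (-(1 / 3) : ℝ) ≤ δ →
      M ≤ 4 * Real.log (4 * M) * #(dyadicPrimes M) →
      ∃ a ∈ dyadicPrimes M, ∃ b ∈ dyadicPrimes M, ∃ m : ℤ, |x / (a * b) + δ - m| < δ := by
  obtain ⟨M₁, hM₁⟩ := Filter.eventually_atTop.mp eventually_log_cube_lt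
  refine ⟨max M₁ (10 ^ 4), fun M hM x δ hx1 hx2 hδM hcard => ?_⟩
  have hlog := hM₁ M ((le_max_left _ _).trans hM)
  have hM4 : (10 : ℝ) ^ 4 ≤ M := (le_max_right _ _).trans hM
  have hM0 : 0 < M := lt_of_lt_of_le (by norm_num) hM4
  by_contra! hcon
  have hδ : 0 < δ := lt_of_lt_of_le (by positivity) hδM
  set A := dyadicPrimes M with hAdef
  have hA : ∀ a ∈ A, a.Prime ∧ M < a ∧ (a : ℝ) ≤ 2 * M := fun a ha =>
    mem_dyadicPrimes hM0.le ha
  -- The least exponent for which `δ ≥ M ^ (-1/3)` guarantees `K ^ 3 δ ^ 4 ≥ 1`.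
  set K := ⌈M ^ (4 / 9 : ℝ)⌉₊ with hKdef
  have hK1 : M ^ (4 / 9 : ℝ) ≤ K := Nat.le_ceil _
  have hK2 : (K : ℝ) < M ^ (4 / 9 : ℝ) + 1 := Nat.ceil_lt_add_one (by positivity)
  have hroot : 10 ≤ M ^ (1 / 4 : ℝ) := by
    have : (10 : ℝ) = (10 ^ 4) ^ (1 / 4 : ℝ) := by
      rw [← Real.rpow_natCast, ← Real.rpow_mul (by norm_num)]
      norm_num
    rw [this]
    exact Real.rpow_le_rpow (by norm_num) hM4 (by norm_num)
  have hquarter : M ^ (1 / 4 : ℝ) ≤ M ^ (4 / 9 : ℝ) :=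
    Real.rpow_le_rpow_of_exponent_le (by linarith) (by norm_num)
  have hKup : (K : ℝ) ≤ 2 * M ^ (4 / 9 : ℝ) := by linarith
  have hK8 : 8 ≤ K := by
    have : (8 : ℝ) ≤ K := by linarith
    exact_mod_cast this
  have hhalf : M ^ (4 / 9 : ℝ) ≤ M ^ (3 / 4 : ℝ) :=
    Real.rpow_le_rpow_of_exponent_le (by linarith) (by norm_num)
  have hmul : M ^ (3 / 4 : ℝ) * M ^ (1 / 4 : ℝ) = M := by
    rw [← Real.rpow_add hM0]
    norm_num
  have hKM : 2 * (K : ℝ) ≤ M := by nlinarith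
  have hKpos : (0 : ℝ) < K := by linarith
  have hKδ : 1 ≤ (K : ℝ) ^ 3 * δ ^ 4 := by
    have e1 : (M ^ (4 / 9 : ℝ)) ^ 3 = M ^ (4 / 3 : ℝ) := by
      rw [← Real.rpow_natCast, ← Real.rpow_mul hM0.le]
      norm_num
    have e2 : (M ^ (-(1 / 3) : ℝ)) ^ 4 = M ^ (-(4 / 3) : ℝ) := by
      rw [← Real.rpow_natCast, ← Real.rpow_mul hM0.le]
      norm_num
    have e3 : M ^ (4 / 3 : ℝ) * M ^ (-(4 / 3) : ℝ) = 1 := by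
      rw [← Real.rpow_add hM0]
      norm_num
    rw [← e3, ← e1, ← e2]
    gcongr
  have hbil := sum_norm_bilinear_sq_le hM0 hA hK8 hKM hx1 hx2
  set B := ∑ h ∈ Ioo 0 (2 * K), ‖∑ a ∈ A, ∑ b ∈ A, expi (h * (x / (a * b)))‖ with hB
  have hlarge := exponential_sums_large (A ×ˢ A) (fun k => x / (k.1 * k.2) + δ) hδ
    (fun k hk m => hcon k.1 (mem_product.mp hk).1 k.2 (mem_product.mp hk).2 m) K
  -- The shift by `δ` only contributes a unimodular factor.
  have hshift : ∀ j : ℕ, ‖∑ k ∈ A ×ˢ A, expi (j * (x / (k.1 * k.2) + δ))‖ =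
      ‖∑ a ∈ A, ∑ b ∈ A, expi (j * (x / (a * b)))‖ := by
    intro j
    simp_rw [mul_add, expi_add]
    rw [← Finset.sum_mul, norm_mul, norm_expi, mul_one, Finset.sum_product]
  simp_rw [hshift] at hlarge
  rw [← hB, Finset.card_product] at hlarge
  push_cast at hlarge
  set P : ℝ := (#A : ℝ) with hP
  set ℓ := Real.log (4 * M) with hℓ
  have hℓ1 : 1 ≤ ℓ := by
    rw [hℓ, Real.le_log_iff_exp_le (by linarith)]
    linarith [Real.exp_one_lt_d9]
  have hPpos : 0 < P := by
    by_contra hc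
    have : P ≤ 0 := not_lt.mp hc
    nlinarith
  have hB0 : 0 ≤ B := Finset.sum_nonneg fun _ _ => norm_nonneg _
  -- The kernel bound uses up at most half of the diagonal `K ^ 3 P ^ 2 / 2`.
  have hPB : P ^ 2 ≤ 8 * B := by
    have h1 : P * P / (16 * δ ^ 4) ≤ K ^ 3 * (P * P) / 4 := by
      rw [div_le_iff₀ (by positivity)]
      nlinarith [mul_le_mul_of_nonneg_left hKδ (mul_pos hPpos hPpos).le]
    have h2 : (K : ℝ) ^ 3 * P ^ 2 ≤ K ^ 3 * (8 * B) := by nlinarith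
    exact le_of_mul_le_mul_left h2 (by positivity)
  have hL : 3 + 2 * Real.log (4 * K * M) ≤ 7 * ℓ := by
    have h1 : Real.log (4 * K * M) ≤ Real.log ((4 * M) * (4 * M)) :=
      Real.log_le_log (by positivity) (by nlinarith)
    rw [Real.log_mul (x := 4 * M) (y := 4 * M) (by positivity) (by positivity)] at h1
    linarith
  have hP2 : P ^ 2 ≤ 64 * (128 * K ^ 2 * M * (7 * ℓ)) := by
    have h1 : P ^ 2 * P ^ 2 ≤ P ^ 2 * (64 * (128 * K ^ 2 * M * (7 * ℓ))) := by
      calc P ^ 2 * P ^ 2 ≤ (8 * B) * (8 * B) := by gcongr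
        _ = 64 * B ^ 2 := by ring
        _ ≤ 64 * (128 * K ^ 2 * M * P ^ 2 * (3 + 2 * Real.log (4 * K * M))) := by gcongr
        _ ≤ 64 * (128 * K ^ 2 * M * P ^ 2 * (7 * ℓ)) := by gcongr
        _ = _ := by ring
    exact le_of_mul_le_mul_left h1 (by positivity)
  exact false_of_bounds hM0 (by linarith) hKpos.le hKup hcard hP2 hlog

theorem mainTheorem5 :
    ∃ c C : ℝ, 0 < c ∧ 0 < C ∧ ∀ ε : ℝ, 0 < ε → ∃ x₀ : ℝ, ∀ x : ℝ, x₀ ≤ x →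
      ∃ p₁ p₂ m : ℕ, p₁.Prime ∧ p₂.Prime ∧
        ((p₁ * p₂ * m : ℕ) : ℝ) ∈ Set.Icc x (x + x ^ (5 / 9 + ε : ℝ)) ∧
        (p₁ : ℝ) ∈ Set.Icc (c * x ^ (1 / 3 : ℝ)) (C * x ^ (1 / 3 : ℝ)) ∧
        (p₂ : ℝ) ∈ Set.Icc (c * x ^ (1 / 3 : ℝ)) (C * x ^ (1 / 3 : ℝ)) ∧
        (m : ℝ) ∈ Set.Icc (c * x ^ (1 / 3 : ℝ)) (C * x ^ (1 / 3 : ℝ)) := by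
  -- `4` comes from `a, b ≤ 2M ≤ 4N`, and `1/16` from `m > x / (a b)` with `a b ≤ 16 N ^ 2`.
  refine ⟨1 / 16, 4, by norm_num, by norm_num, fun ε₀ hε₀ => ?_⟩
  obtain ⟨M₀, hM₀⟩ := exists_near_integer
  -- Shrinking `ε` to at most `1/9` gives `H ≤ N ^ 2`, hence `2δ ≤ 1`, which keeps `m` below `N +
  -- 1`.
  obtain ⟨ε, hε, hεε₀, hε9⟩ : ∃ ε : ℝ, 0 < ε ∧ ε ≤ ε₀ ∧ ε ≤ 1 / 9 :=
    ⟨min ε₀ (1 / 9), lt_min hε₀ (by norm_num), min_le_left _ _, min_le_right _ _⟩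
  have hroot : Filter.Tendsto (fun x : ℝ => x ^ (1 / 3 : ℝ)) Filter.atTop Filter.atTop :=
    tendsto_rpow_atTop (by norm_num)
  have hpow : Filter.Tendsto (fun N : ℝ => N ^ (3 * ε)) Filter.atTop Filter.atTop :=
    tendsto_rpow_atTop (by positivity)
  have hall : ∀ᶠ N : ℝ in Filter.atTop, (∃ M : ℝ, (M = N ∨ M = 2 * N) ∧
      M ≤ 4 * Real.log (4 * M) * #(dyadicPrimes M)) ∧ 32 ≤ N ^ (3 * ε) ∧ M₀ ≤ N ∧ 1 ≤ N := by
    filter_upwards [eventually_card_dyadicPrimes, hpow.eventually_ge_atTop 32,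
      Filter.eventually_ge_atTop M₀, Filter.eventually_ge_atTop 1] with N h1 h2 h3 h4
    exact ⟨h1, h2, h3, h4⟩
  obtain ⟨x₀, hx₀⟩ := Filter.eventually_atTop.mp
    ((hroot.eventually hall).and (Filter.eventually_ge_atTop 1))
  refine ⟨x₀, fun x hx => ?_⟩
  obtain ⟨⟨⟨M, hMN, hcard⟩, hN32, hNM₀, hN1⟩, hx1⟩ := hx₀ x hx
  have hx0 : 0 < x := by linarith
  set N := x ^ (1 / 3 : ℝ) with hN
  have hN0 : 0 < N := by linarith
  have hN3 : N ^ 3 = x := by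
    rw [hN, ← Real.rpow_natCast, ← Real.rpow_mul hx0.le]
    norm_num
  have hNM : N ≤ M := by rcases hMN with h | h <;> linarith
  have hM2N : M ≤ 2 * N := by rcases hMN with h | h <;> linarith
  have hM0 : 0 < M := by linarith
  set H := x ^ (5 / 9 + ε : ℝ) with hH
  have hH0 : 0 < H := by positivity
  have hHle : H ≤ x ^ (5 / 9 + ε₀ : ℝ) :=
    Real.rpow_le_rpow_of_exponent_le hx1 (by linarith)
  have hH2 : H ≤ N ^ 2 := by
    rw [hN, ← Real.rpow_natCast, ← Real.rpow_mul hx0.le, hH]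
    exact Real.rpow_le_rpow_of_exponent_le hx1 (by push_cast; linarith)
  have hHN : H = N ^ (5 / 3 : ℝ) * N ^ (3 * ε) := by
    rw [← Real.rpow_add hN0, hN, ← Real.rpow_mul hx0.le, hH]
    congr 1
    ring
  -- Since `a b ≤ 4 M ^ 2`, the window `2δ` for `m` becomes at most `H` for `a b m`. The bound `N ^
  -- (3ε) ≥ 32` absorbs `8 M ^ 2 ≤ 32 N ^ 2` when `δ` is compared with `M ^ (-1/3)`.
  set δ := H / (8 * M ^ 2) with hδ
  have hδ0 : 0 < δ := by positivity
  have hδM : M ^ (-(1 / 3) : ℝ) ≤ δ := by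
    have h1 : M ^ (-(1 / 3) : ℝ) ≤ N ^ (-(1 / 3) : ℝ) :=
      Real.rpow_le_rpow_of_nonpos hN0 hNM (by norm_num)
    have h2 : N ^ (-(1 / 3) : ℝ) * N ^ 2 = N ^ (5 / 3 : ℝ) := by
      rw [← Real.rpow_natCast, ← Real.rpow_add hN0]
      norm_num
    refine h1.trans ?_
    rw [hδ, le_div_iff₀ (by positivity), hHN, ← h2]
    have h3 : 0 < N ^ (-(1 / 3) : ℝ) := by positivity
    have h4 : 8 * M ^ 2 ≤ N ^ 2 * N ^ (3 * ε) := by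
      have h5 := pow_le_pow_left₀ hM0.le hM2N 2
      have h6 := mul_le_mul_of_nonneg_left hN32 (sq_nonneg N)
      rw [mul_pow] at h5
      linarith
    rw [mul_assoc]
    exact mul_le_mul_of_nonneg_left h4 h3.le
  obtain ⟨a, ha, b, hb, m, hm⟩ := hM₀ M (hNM₀.trans hNM) x δ
    (by rw [← hN3]; linarith [pow_le_pow_left₀ hM0.le hM2N 3, mul_pow 2 N 3])
    (by rw [← hN3]; exact pow_le_pow_left₀ hN0.le hNM 3) hδM hcard
  obtain ⟨hap, ha1, ha2⟩ := mem_dyadicPrimes hM0.le ha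
  obtain ⟨hbp, hb1, hb2⟩ := mem_dyadicPrimes hM0.le hb
  have ha0 : (0 : ℝ) < a := by linarith
  have hb0 : (0 : ℝ) < b := by linarith
  obtain ⟨hm1, hm2⟩ := abs_lt.mp hm
  have hm3 : x / (a * b) < m := by linarith
  have hm4 : (m : ℝ) < x / (a * b) + 2 * δ := by linarith
  have hmpos : (0 : ℝ) < m := lt_trans (by positivity) hm3
  have hm0 : 0 ≤ m := by
    have : 0 < m := by exact_mod_cast hmpos
    exact this.le
  lift m to ℕ using hm0
  rw [Int.cast_natCast] at hm3 hm4
  have hab : (a : ℝ) * b ≤ 4 * M ^ 2 :=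
    (mul_le_mul ha2 hb2 hb0.le (by positivity)).trans (le_of_eq (by ring))
  have hab' : N ^ 2 ≤ (a : ℝ) * b := by
    rw [sq]
    exact mul_le_mul (by linarith) (by linarith) hN0.le ha0.le
  have hcancel : x / (a * b) * (a * b) = x := div_mul_cancel₀ _ (by positivity)
  refine ⟨a, b, m, hap, hbp, ⟨?_, ?_⟩, ⟨by linarith, by linarith⟩, ⟨by linarith, by linarith⟩,
    ?_, ?_⟩
  · push_cast
    rw [div_lt_iff₀ (by positivity)] at hm3
    linarith
  · push_cast
    have h1 : (m : ℝ) * (a * b) ≤ (x / (a * b) + 2 * δ) * (a * b) :=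
      mul_le_mul_of_nonneg_right hm4.le (by positivity)
    have h2 : 2 * δ * (a * b) ≤ 2 * δ * (4 * M ^ 2) :=
      mul_le_mul_of_nonneg_left hab (by positivity)
    have h3 : 2 * δ * (4 * M ^ 2) = H := by
      rw [hδ]
      field_simp
      norm_num
    rw [add_mul, hcancel] at h1
    linarith
  · refine le_trans ?_ hm3.le
    rw [le_div_iff₀ (by positivity), ← hN3]
    have h1 : (a : ℝ) * b ≤ 16 * N ^ 2 :=
      hab.trans (by linarith [pow_le_pow_left₀ hM0.le hM2N 2, mul_pow 2 N 2])
    calc 1 / 16 * N * (a * b) ≤ 1 / 16 * N * (16 * N ^ 2) :=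
          mul_le_mul_of_nonneg_left h1 (by positivity)
      _ = N ^ 3 := by ring
  · have h1 : x / (a * b) ≤ N := by
      rw [div_le_iff₀ (by positivity), ← hN3, pow_succ']
      exact mul_le_mul_of_nonneg_left hab' hN0.le
    have h2 : 2 * δ ≤ 1 := by
      rw [hδ, ← mul_div_assoc, div_le_one (by positivity)]
      linarith [pow_le_pow_left₀ hN0.le hNM 2, sq_nonneg M]
    linarith
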